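/- **Setting.** Let $K$ be a number field with algebraic closure $\overline K$, $G_K=\mathrm{Gal}(\overline K/K)$, $l$ a prime, $n$ an odd integer, $V_l$ a finite-dimensional $\mathbb{Q}_l$-vector space with a nondegenerate alternating form $\psi_l$, and $\rho_l:G_K\to \mathrm{GL}(V_l)$ a continuous representation such that $\psi_l(\rho_l(\sigma)v,\rho_l(\sigma)w)=\chi_c(\sigma)^{-n}\psi_l(v,w)$ for all $\sigma\in G_K$ and $v,w\in V_l$, where $\chi_c$ is the $l$-adic cyclotomic character (i.e. $\psi_l:V_l\times V_l\to\mathbb{Q}_l(-n)$ is $G_K$-equivariant). Let $\mathrm{GIso}\subset \mathrm{GL}_{V_l}$ be the group scheme of similitudes of $\psi_l$, and let $\mathrm{Iso}$ be the subgroup of isometries (multiplier $1$). For a closed subgroup $G_L=\mathrm{Gal}(\overline K/L)$ of $G_K$ put * $\rho_l(G_L)_1=\rho_l(G_L)\cap \mathrm{Iso}(\mathbb{Q}_l)$; * $G^{\mathrm{alg}}_{l,L}$ = the Zariski closure of $\rho_l(G_L)$ in $\mathrm{GIso}$, a closed subgroup scheme over $\mathbb{Q}_l$, and $G^{\mathrm{alg}}_{l,L,1}=G^{\mathrm{alg}}_{l,L}\cap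 \mathrm{Iso}$. Let $K_0\subset\overline K$ be the fixed field of $\{\sigma\in G_K:\rho_l(\sigma)\in (G^{\mathrm{alg}}_{l,K})^{\circ}(\mathbb{Q}_l)\}$, where $^\circ$ is the identity component. Put $\bar l=l$ if $l>2$ and $\bar l=8$ if $l=2$, and let $K(\mu_{\bar l}^{\otimes n})$ be the fixed field of the kernel of $(\chi_c \bmod \bar l)^n$. **Theorem.** Assume that 1. $K_0\cap K(\mu_{\bar l}^{\otimes n})=K$; 2. $(1+l\mathbb{Z}_l)\,\mathrm{Id}_{V_l}\subset\rho_l(G_K)$. Then $\rho_l(G_{K_0})$, $\rho_l(G_{K_0})_1$, $G^{\mathrm{alg}}_{l,K_0}$, $G^{\mathrm{alg}}_{l,K_0,1}$ are normal in the corresponding groups for $K$, and all the natural homomorphisms in the commutative square $$\begin{array}{ccc} \rho_l(G_K)/\rho_l(G_{K_0}) & \xrightarrow{\ \mathrm{Zar}\ } & G^{\mathrm{alg}}_{l,K}/G^{\mathrm{alg}}_{l,K_0}\\ {\scriptstyle j}\uparrow & & \uparrow{\scriptstyle i}\\ \rho_l(G_K)_1/\rho_l(G_{K_0})_1 & \xrightarrow{\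 \mathrm{Zar}_1\ } & G^{\mathrm{alg}}_{l,K,1}/G^{\mathrm{alg}}_{l,K_0,1} \end{array}$$ are isomorphisms. Here the groups on the left are regarded as constant group schemes; explicitly, the four maps are isomorphisms of groups on points in every commutative $\mathbb{Q}_l$-algebra $R$ with connected spectrum (for instance $R=\overline{\mathbb{Q}}_l$). Moreover, every coset of $G_{K_0}$ in $G_K$ has the form $\tilde\sigma_1G_{K_0}$ with $\rho_l(\tilde\sigma_1)\in\rho_l(G_K)_1$, and for any choice of one such representative $\tilde\sigma_1$ in each coset, $$\rho_l(G_K)_1=\bigsqcup_{\tilde\sigma_1G_{K_0}}\rho_l(\tilde\sigma_1)\,\rho_l(G_{K_0})_1,\qquad G^{\mathrm{alg}}_{l,K,1}=\bigsqcup_{\tilde\sigma_1G_{K_0}}\rho_l(\tilde\sigma_1)\,G^{\mathrm{alg}}_{l,K_0,1},$$ the second decomposition being one of schemes, i.e. it holds on $R$-points for every commutative $\mathbb{Q}_l$-algebra $R$ with connected spectrum. -/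

import Mathlib

open scoped Matrix Pointwise

namespace GaloisZariski

section LinearGroups

/-!
Algebraic subgroups of `GL` over a field `k`, viewed through their points in all commutative
`k`-algebras `R` and through closed subsets of the prime spectrum.
-/

/-- The variables `x i j` (first summand) and `y i j` (second summand) used to write
functions on the general linear group: `x` stands for a matrix and `y` for its inverse. -/
abbrev Idx (ι : Type*) := (ι × ι) ⊕ (ι × ι)

/-- Polynomials in the entries of a matrix and of its inverse. The coordinate ring of the
general linear group is the quotient of this ring by the relations `x * y = 1`, so that the
general linear group is a closed subscheme of the spectrum of this ring. -/
abbrev Poly (ι k : Type*) [CommRing k] := MvPolynomial (Idx ι) k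

variable {ι : Type*} [Fintype ι] [DecidableEq ι] {k : Type*} [Field k]
variable {R : Type*} [CommRing R] [Algebra k R]

/-- The entries of an invertible matrix, followed by the entries of its inverse. -/
def coords {R : Type*} [CommRing R] (g : GL ι R) : Idx ι → R :=
  Sum.elim (fun p => (g : Matrix ι ι R) p.1 p.2) (fun p => ((g⁻¹ : GL ι R) : Matrix ι ι R) p.1 p.2)

/-- Evaluation of a function on the general linear group at an `R`-point. -/
noncomputable def evalAt (k : Type*) [Field k] {R : Type*} [CommRing R] [Algebra k R]
    (g : GL ι R) : Poly ι k →ₐ[k] R :=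
  MvPolynomial.aeval (coords g)

/-- The group homomorphism `GL(k) → GL(R)` given by base change. -/
noncomputable abbrev toPoints (ι : Type*) [Fintype ι] [DecidableEq ι] (k R : Type*) [Field k]
    [CommRing R] [Algebra k R] : GL ι k →* GL ι R :=
  Matrix.GeneralLinearGroup.map (algebraMap k R)

/-- The ideal of all functions vanishing on a set of `k`-points. -/
noncomputable def vanIdeal (S : Set (GL ι k)) : Ideal (Poly ι k) :=
  ⨅ s ∈ S, RingHom.ker (evalAt k s)

lemma mem_vanIdeal {S : Set (GL ι k)} {f : Poly ι k} :
    f ∈ vanIdeal S ↔ ∀ s ∈ S, evalAt k s f = 0 := by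
  simp [vanIdeal, RingHom.mem_ker]

lemma coords_toPoints (s : GL ι k) (i : Idx ι) :
    coords (toPoints ι k R s) i = algebraMap k R (coords s i) := by
  rcases i with p | p
  · simp [coords]
  · simp [coords, ← map_inv]

lemma evalAt_toPoints (s : GL ι k) (f : Poly ι k) :
    evalAt k (toPoints ι k R s) f = algebraMap k R (evalAt k s f) := by
  have : coords (toPoints ι k R s) = fun i => algebraMap k R (coords s i) :=
    funext (coords_toPoints s)
  simp only [evalAt, this]
  exact MvPolynomial.aeval_algebraMap_apply _ _ _

/-- If a polynomial with coefficients in `R` vanishes on a set of `k`-points, then it vanishes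
on every `R`-point of the Zariski closure of that set. -/
lemma eval_eq_zero_of_closure (S : Set (GL ι k)) (P : MvPolynomial (Idx ι) R)
    (hP : ∀ s ∈ S, MvPolynomial.eval (coords (toPoints ι k R s)) P = 0) (g : GL ι R)
    (hg : ∀ f ∈ vanIdeal S, evalAt k g f = 0) : MvPolynomial.eval (coords g) P = 0 := by
  classical
  let b := Module.Basis.ofVectorSpace k R
  let F : Module.Basis.ofVectorSpaceIndex k R → Poly ι k := fun i =>
    ∑ m ∈ P.support, MvPolynomial.monomial m (b.repr (P.coeff m) i)
  let T : Finset (Module.Basis.ofVectorSpaceIndex k R) :=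
    P.support.biUnion fun m => (b.repr (P.coeff m)).support
  have key : ∀ h : GL ι R, MvPolynomial.eval (coords h) P = ∑ i ∈ T, b i * evalAt k h (F i) := by
    intro h
    have hc : ∀ m ∈ P.support, P.coeff m = ∑ i ∈ T, algebraMap k R (b.repr (P.coeff m) i) * b i := by
      intro m hm
      conv_lhs => rw [← b.linearCombination_repr (P.coeff m)]
      rw [Finsupp.linearCombination_apply, Finsupp.sum]
      rw [Finset.sum_subset (Finset.subset_biUnion_of_mem
        (fun m => (b.repr (P.coeff m)).support) hm)]
      · exact Finset.sum_congr rfl fun i _ => Algebra.smul_def _ _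
      · intro i _ hi
        rw [Finsupp.notMem_support_iff.mp hi, zero_smul]
    rw [MvPolynomial.eval_eq]
    calc ∑ m ∈ P.support, P.coeff m * ∏ i ∈ m.support, coords h i ^ m i
        = ∑ m ∈ P.support, ∑ i ∈ T, b i * (algebraMap k R (b.repr (P.coeff m) i) *
            ∏ j ∈ m.support, coords h j ^ m j) := by
          refine Finset.sum_congr rfl fun m hm => ?_
          conv_lhs => rw [hc m hm]
          rw [Finset.sum_mul]
          exact Finset.sum_congr rfl fun i _ => by ring
      _ = ∑ i ∈ T, b i * evalAt k h (F i) := by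
          rw [Finset.sum_comm]
          refine Finset.sum_congr rfl fun i _ => ?_
          rw [← Finset.mul_sum]
          congr 1
          simp only [F, evalAt, map_sum, MvPolynomial.aeval_monomial]
          rfl
  have hF : ∀ i, F i ∈ vanIdeal S := by
    intro i
    rw [mem_vanIdeal]
    intro s hs
    have h0 := hP s hs
    have h1 : b.repr (MvPolynomial.eval (coords (toPoints ι k R s)) P) i = evalAt k s (F i) := by
      rw [MvPolynomial.eval_eq]
      simp only [map_sum, Finsupp.coe_finsetSum, Finset.sum_apply, F, evalAt,
        MvPolynomial.aeval_monomial]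
      refine Finset.sum_congr rfl fun m _ => ?_
      have : ∏ j ∈ m.support, coords (toPoints ι k R s) j ^ m j
          = algebraMap k R (∏ j ∈ m.support, coords s j ^ m j) := by
        simp [coords_toPoints]
      rw [this, mul_comm, ← Algebra.smul_def, map_smul, Finsupp.smul_apply, smul_eq_mul, mul_comm]
      rfl
    rw [← h1, h0]
    simp
  rw [key g]
  exact Finset.sum_eq_zero fun i _ => by rw [hg _ (hF i), mul_zero]

/-- The generic matrix. -/
noncomputable def genMat (ι R : Type*) [CommRing R] : Matrix ι ι (MvPolynomial (Idx ι) R) :=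
  Matrix.of fun i j => MvPolynomial.X (Sum.inl (i, j))

/-- The matrix of the variables that stand for the entries of the inverse. -/
noncomputable def genInv (ι R : Type*) [CommRing R] : Matrix ι ι (MvPolynomial (Idx ι) R) :=
  Matrix.of fun i j => MvPolynomial.X (Sum.inr (i, j))

/-- A matrix of constants. -/
noncomputable def constMat {R : Type*} [CommRing R] (a : Matrix ι ι R) :
    Matrix ι ι (MvPolynomial (Idx ι) R) :=
  a.map MvPolynomial.C

/-- The coordinates of `a * x * b` as polynomials in the coordinates of `x`. -/
noncomputable def transVar {R : Type*} [CommRing R] (a b : GL ι R) :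
    Idx ι → MvPolynomial (Idx ι) R :=
  Sum.elim (fun p => (constMat (a : Matrix ι ι R) * genMat ι R * constMat (b : Matrix ι ι R)) p.1 p.2)
    (fun p => (constMat ((b⁻¹ : GL ι R) : Matrix ι ι R) * genInv ι R *
      constMat ((a⁻¹ : GL ι R) : Matrix ι ι R)) p.1 p.2)

/-- The coordinates of `x * h * x⁻¹` as polynomials in the coordinates of `x`. -/
noncomputable def conjVar {R : Type*} [CommRing R] (h : GL ι R) : Idx ι → MvPolynomial (Idx ι) R :=
  Sum.elim (fun p => (genMat ι R * constMat (h : Matrix ι ι R) * genInv ι R) p.1 p.2)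
    (fun p => (genMat ι R * constMat ((h⁻¹ : GL ι R) : Matrix ι ι R) * genInv ι R) p.1 p.2)

lemma map_genMat {R A : Type*} [CommRing R] [CommRing A] [Algebra R A] (x : GL ι A) :
    (genMat ι R).map (MvPolynomial.aeval (coords x)) = (x : Matrix ι ι A) := by
  ext i j
  simp [genMat, coords]

lemma map_genInv {R A : Type*} [CommRing R] [CommRing A] [Algebra R A] (x : GL ι A) :
    (genInv ι R).map (MvPolynomial.aeval (coords x)) = ((x⁻¹ : GL ι A) : Matrix ι ι A) := by
  ext i j
  simp [genInv, coords]

lemma map_constMat {R A : Type*} [CommRing R] [CommRing A] [Algebra R A] (x : GL ι A)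
    (a : Matrix ι ι R) :
    (constMat a).map (MvPolynomial.aeval (coords x)) = a.map (algebraMap R A) := by
  ext i j
  simp [constMat]

lemma map_mul_mul {ι : Type*} [Fintype ι] {A B : Type*} [CommRing A] [CommRing B] (φ : A →+* B) (L M N : Matrix ι ι A)
    (i j : ι) : φ ((L * M * N) i j) = (L.map φ * M.map φ * N.map φ) i j := by
  rw [← Matrix.map_mul, ← Matrix.map_mul, Matrix.map_apply]

lemma aeval_transVar {R A : Type*} [CommRing R] [CommRing A] [Algebra R A] (a b : GL ι R)
    (x : GL ι A) (i : Idx ι) : MvPolynomial.aeval (coords x) (transVar a b i) =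
      coords (Matrix.GeneralLinearGroup.map (algebraMap R A) a * x *
        Matrix.GeneralLinearGroup.map (algebraMap R A) b) i := by
  rcases i with p | p
  · have := map_mul_mul (MvPolynomial.aeval (R := R) (coords x)).toRingHom
      (constMat (a : Matrix ι ι R)) (genMat ι R) (constMat (b : Matrix ι ι R)) p.1 p.2
    refine this.trans ?_
    exact congrArg (fun M : Matrix ι ι A => M p.1 p.2)
      (congrArg₂ (· * ·) (congrArg₂ (· * ·) (map_constMat x _) (map_genMat x)) (map_constMat x _))
  · have := map_mul_mul (MvPolynomial.aeval (R := R) (coords x)).toRingHom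
      (constMat ((b⁻¹ : GL ι R) : Matrix ι ι R)) (genInv ι R)
      (constMat ((a⁻¹ : GL ι R) : Matrix ι ι R)) p.1 p.2
    refine this.trans ?_
    simp only [coords, Sum.elim_inr, mul_inv_rev, ← map_inv, ← mul_assoc]
    exact congrArg (fun M : Matrix ι ι A => M p.1 p.2)
      (congrArg₂ (· * ·) (congrArg₂ (· * ·) (map_constMat x _) (map_genInv x)) (map_constMat x _))

lemma aeval_conjVar {R : Type*} [CommRing R] (h x : GL ι R) (i : Idx ι) :
    MvPolynomial.aeval (coords x) (conjVar h i) = coords (x * h * x⁻¹) i := by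
  rcases i with p | p
  · have := map_mul_mul (MvPolynomial.aeval (R := R) (coords x)).toRingHom
      (genMat ι R) (constMat (h : Matrix ι ι R)) (genInv ι R) p.1 p.2
    refine this.trans ?_
    exact congrArg (fun M : Matrix ι ι R => M p.1 p.2)
      (congrArg₂ (· * ·) (congrArg₂ (· * ·) (map_genMat x) (map_constMat x _)) (map_genInv x))
  · have := map_mul_mul (MvPolynomial.aeval (R := R) (coords x)).toRingHom
      (genMat ι R) (constMat ((h⁻¹ : GL ι R) : Matrix ι ι R)) (genInv ι R) p.1 p.2
    refine this.trans ?_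
    simp only [coords, Sum.elim_inr, mul_inv_rev, inv_inv, ← mul_assoc]
    exact congrArg (fun M : Matrix ι ι R => M p.1 p.2)
      (congrArg₂ (· * ·) (congrArg₂ (· * ·) (map_genMat x) (map_constMat x _)) (map_genInv x))

/-- To check that `g ↦ f (w g)` vanishes on the closure of `S`, where `w` is given by
polynomials `v` over `R`, it is enough to check it on `S`. -/
lemma evalAt_comp_eq_zero (S : Set (GL ι k)) (v : Idx ι → MvPolynomial (Idx ι) R)
    (w : GL ι R → GL ι R) (hw : ∀ x i, MvPolynomial.aeval (coords x) (v i) = coords (w x) i)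
    (f : Poly ι k) (hf : ∀ s ∈ S, evalAt k (w (toPoints ι k R s)) f = 0) (g : GL ι R)
    (hg : ∀ f ∈ vanIdeal S, evalAt k g f = 0) : evalAt k (w g) f = 0 := by
  have key : ∀ x : GL ι R,
      MvPolynomial.eval (coords x) (MvPolynomial.aeval v f) = evalAt k (w x) f := by
    intro x
    have h1 : (MvPolynomial.aeval (R := R) (coords x) : MvPolynomial (Idx ι) R →ₐ[R] R)
        (MvPolynomial.aeval v f) = evalAt k (w x) f := by
      have h2 := MvPolynomial.comp_aeval_apply v
        ((MvPolynomial.aeval (R := R) (coords x)).restrictScalars k) f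
      have h3 : (fun i => ((MvPolynomial.aeval (R := R) (coords x)).restrictScalars k) (v i))
          = coords (w x) := funext fun i => hw x i
      rw [h3] at h2
      exact h2
    rw [← h1]
    exact congrArg (fun φ : MvPolynomial (Idx ι) R →+* R => φ (MvPolynomial.aeval v f))
      (MvPolynomial.coe_aeval_eq_eval (coords x)).symm
  rw [← key]
  exact eval_eq_zero_of_closure S _ (fun s hs => by rw [key]; exact hf s hs) g hg

lemma map_id_GL {R : Type*} [CommRing R] (a : GL ι R) :
    Matrix.GeneralLinearGroup.map (algebraMap R R) a = a := by
  ext i j; rfl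

/-- The `R`-points of the Zariski closure of a group `S` of `k`-points in the general linear
group: the invertible matrices over `R` on which all functions that vanish on `S` vanish.
If `S` lies in a closed subgroup of the general linear group, such as the group of similitudes of a
form, this is also the Zariski closure of `S` in that subgroup. -/
def zariskiClosure (S : Subgroup (GL ι k)) (R : Type*) [CommRing R] [Algebra k R] :
    Subgroup (GL ι R) where
  carrier := {g | ∀ f ∈ vanIdeal (S : Set (GL ι k)), evalAt k g f = 0}
  one_mem' := by
    intro f hf
    have := evalAt_toPoints (R := R) (1 : GL ι k) f
    rw [map_one] at this
    rw [this, mem_vanIdeal.mp hf 1 S.one_mem, map_zero]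
  mul_mem' := by
    intro g h hg hh f hf
    have h1 : ∀ s ∈ (S : Set (GL ι k)), evalAt k (toPoints ι k R s * h) f = 0 := by
      intro s hs
      refine evalAt_comp_eq_zero (S : Set (GL ι k)) (transVar (toPoints ι k R s) 1)
        (fun x => toPoints ι k R s * x) (fun x i => ?_) f (fun t ht => ?_) h hh
      · rw [aeval_transVar, map_id_GL, map_id_GL, mul_one]
      · rw [← map_mul, evalAt_toPoints, mem_vanIdeal.mp hf _ (S.mul_mem hs ht), map_zero]
    refine evalAt_comp_eq_zero (S : Set (GL ι k)) (transVar 1 h) (fun x => x * h)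
      (fun x i => ?_) f h1 g hg
    rw [aeval_transVar, map_id_GL, map_id_GL, one_mul]
  inv_mem' := by
    intro g hg f hf
    refine evalAt_comp_eq_zero (S : Set (GL ι k))
      (fun i => MvPolynomial.X (Sum.swap i)) (fun x => x⁻¹) (fun x i => ?_) f (fun t ht => ?_) g hg
    · rcases i with p | p <;> simp [coords]
    · rw [← map_inv, evalAt_toPoints, mem_vanIdeal.mp hf _ (S.inv_mem ht), map_zero]

lemma mem_zariskiClosure {S : Subgroup (GL ι k)} {g : GL ι R} :
    g ∈ zariskiClosure S R ↔ ∀ f ∈ vanIdeal (S : Set (GL ι k)), evalAt k g f = 0 :=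
  Iff.rfl

lemma toPoints_mem_zariskiClosure {S : Subgroup (GL ι k)} {s : GL ι k} (hs : s ∈ S) :
    toPoints ι k R s ∈ zariskiClosure S R := by
  intro f hf
  rw [evalAt_toPoints, mem_vanIdeal.mp hf s hs, map_zero]

lemma zariskiClosure_mono {S T : Subgroup (GL ι k)} (h : S ≤ T) :
    zariskiClosure S R ≤ zariskiClosure T R := by
  intro g hg f hf
  exact hg f (mem_vanIdeal.mpr fun s hs => mem_vanIdeal.mp hf s (h hs))

/-- If `S` is normalized by `T`, then the closure of `S` is normalized by that of `T`. -/
lemma zariskiClosure_conj {S T : Subgroup (GL ι k)} (hST : ∀ t ∈ T, ∀ s ∈ S, t * s * t⁻¹ ∈ S)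
    {g h : GL ι R} (hg : g ∈ zariskiClosure T R) (hh : h ∈ zariskiClosure S R) :
    g * h * g⁻¹ ∈ zariskiClosure S R := by
  intro f hf
  refine evalAt_comp_eq_zero (T : Set (GL ι k)) (conjVar h) (fun x => x * h * x⁻¹)
    (fun x i => aeval_conjVar h x i) f (fun t ht => ?_) g hg
  refine evalAt_comp_eq_zero (S : Set (GL ι k)) (transVar (toPoints ι k R t) (toPoints ι k R t⁻¹))
    (fun x => toPoints ι k R t * x * (toPoints ι k R t)⁻¹) (fun x i => ?_) f (fun s hs => ?_) h hh
  · rw [aeval_transVar, map_id_GL, map_id_GL, map_inv]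
  · rw [← map_mul, ← map_inv, ← map_mul, evalAt_toPoints, mem_vanIdeal.mp hf _ (hST t ht s hs),
      map_zero]

/-- The point of the spectrum defined by a `k`-point of the general linear group. -/
noncomputable def specPt (g : GL ι k) : PrimeSpectrum (Poly ι k) :=
  ⟨RingHom.ker (evalAt k g), RingHom.ker_isPrime _⟩

/-- The identity component of the Zariski closure of `S`: the connected component of the unit
point in the closed subset of the spectrum that underlies the Zariski closure of `S`. -/
noncomputable def identityComponent (S : Subgroup (GL ι k)) : Set (PrimeSpectrum (Poly ι k)) :=
  connectedComponentIn (PrimeSpectrum.zeroLocus (vanIdeal (S : Set (GL ι k)) : Set (Poly ι k)))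
    (specPt 1)

/-- Precomposition with `x ↦ a * x * b` on functions. -/
noncomputable def transHom (a b : GL ι k) : Poly ι k →ₐ[k] Poly ι k :=
  MvPolynomial.aeval (transVar a b)

lemma evalAt_transHom (a b g : GL ι k) (f : Poly ι k) :
    evalAt k g (transHom a b f) = evalAt k (a * g * b) f := by
  have h2 := MvPolynomial.comp_aeval_apply (transVar a b) (evalAt k g) f
  have h3 : (fun i => (evalAt k g) (transVar a b i)) = coords (a * g * b) := by
    funext i
    rw [evalAt, aeval_transVar, map_id_GL, map_id_GL]
  rw [h3] at h2
  exact h2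

lemma comap_transHom_specPt (a b g : GL ι k) :
    PrimeSpectrum.comap (transHom a b).toRingHom (specPt g) = specPt (a * g * b) := by
  ext f
  change evalAt k g (transHom a b f) = 0 ↔ evalAt k (a * g * b) f = 0
  rw [evalAt_transHom]

lemma specPt_mem_zeroLocus {S : Subgroup (GL ι k)} {g : GL ι k} :
    specPt g ∈ PrimeSpectrum.zeroLocus (vanIdeal (S : Set (GL ι k)) : Set (Poly ι k)) ↔
      g ∈ zariskiClosure S k :=
  Iff.rfl

/-- A translation `x ↦ a * x * b` which preserves the closure of `S` and moves some `k`-point of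
the identity component into the identity component, preserves the identity component. -/
lemma transHom_mem_identityComponent {S : Subgroup (GL ι k)} {a b g₀ g : GL ι k}
    (hab : ∀ s ∈ S, a * s * b ∈ zariskiClosure S k)
    (h₀ : specPt g₀ ∈ identityComponent S) (h₁ : specPt (a * g₀ * b) ∈ identityComponent S)
    (hg : specPt g ∈ identityComponent S) : specPt (a * g * b) ∈ identityComponent S := by
  set Z := PrimeSpectrum.zeroLocus (vanIdeal (S : Set (GL ι k)) : Set (Poly ι k))
  set φ := PrimeSpectrum.comap (transHom a b).toRingHom
  have hφ : Continuous φ := PrimeSpectrum.continuous_comap _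
  have hsub : φ '' identityComponent S ⊆ Z := by
    rintro _ ⟨p, hp, rfl⟩ f hf
    have hpZ : p ∈ Z := connectedComponentIn_subset _ _ hp
    refine hpZ (?_ : transHom a b f ∈ vanIdeal (S : Set (GL ι k)))
    rw [mem_vanIdeal]
    intro s hs
    rw [evalAt_transHom]
    exact hab s hs f hf
  have hpre : IsPreconnected (φ '' identityComponent S) :=
    isPreconnected_connectedComponentIn.image _ hφ.continuousOn
  have hmem : ∀ x, specPt x ∈ identityComponent S →
      specPt (a * x * b) ∈ φ '' identityComponent S :=
    fun x hx => ⟨specPt x, hx, comap_transHom_specPt a b x⟩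
  have := hpre.subset_connectedComponentIn (hmem g₀ h₀) hsub (hmem g hg)
  rwa [← connectedComponentIn_eq h₁] at this

lemma one_mem_identityComponent (S : Subgroup (GL ι k)) :
    specPt (1 : GL ι k) ∈ identityComponent S :=
  mem_connectedComponentIn (specPt_mem_zeroLocus.mpr (one_mem _))

lemma mem_zariskiClosure_of_identityComponent {S : Subgroup (GL ι k)} {g : GL ι k}
    (hg : specPt g ∈ identityComponent S) : g ∈ zariskiClosure S k :=
  specPt_mem_zeroLocus.mp (connectedComponentIn_subset _ _ hg)

lemma le_zariskiClosure {S : Subgroup (GL ι k)} : S ≤ zariskiClosure S k := by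
  intro s hs f hf
  exact mem_vanIdeal.mp hf s hs

/-- The group of `k`-points of the identity component of the Zariski closure of `S`. -/
noncomputable def identityPoints (S : Subgroup (GL ι k)) : Subgroup (GL ι k) where
  carrier := {g | specPt g ∈ identityComponent S}
  one_mem' := one_mem_identityComponent S
  mul_mem' := by
    intro g h hg hh
    have := transHom_mem_identityComponent (S := S) (a := g) (b := 1) (g₀ := 1) (g := h)
      (fun s hs => by
        rw [mul_one]
        exact mul_mem (mem_zariskiClosure_of_identityComponent hg) (le_zariskiClosure hs))
      (one_mem_identityComponent S) (by simpa using hg) hh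
    simpa using this
  inv_mem' := by
    intro g hg
    have := transHom_mem_identityComponent (S := S) (a := g⁻¹) (b := 1) (g₀ := g) (g := 1)
      (fun s hs => by
        rw [mul_one]
        exact mul_mem (inv_mem (mem_zariskiClosure_of_identityComponent hg))
          (le_zariskiClosure hs))
      hg (by simpa using one_mem_identityComponent S) (one_mem_identityComponent S)
    simpa using this

lemma identityPoints_conj {S : Subgroup (GL ι k)} {s g : GL ι k} (hs : s ∈ S)
    (hg : g ∈ identityPoints S) : s * g * s⁻¹ ∈ identityPoints S :=
  transHom_mem_identityComponent (S := S) (a := s) (b := s⁻¹) (g₀ := 1) (g := g)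
    (fun t ht => le_zariskiClosure (S.mul_mem (S.mul_mem hs ht) (S.inv_mem hs)))
    (one_mem_identityComponent S) (by simpa using one_mem_identityComponent S) hg

/-- The `R`-points of the isometry group of the bilinear form with Gram matrix `ψ`. -/
def isoGroup (ψ : Matrix ι ι k) (R : Type*) [CommRing R] [Algebra k R] : Subgroup (GL ι R) where
  carrier := {g | (g : Matrix ι ι R)ᵀ * ψ.map (algebraMap k R) * (g : Matrix ι ι R) =
    ψ.map (algebraMap k R)}
  one_mem' := by simp
  mul_mem' := by
    intro g h hg hh
    simp only [Set.mem_ofPred_eq] at hg hh ⊢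
    rw [Units.val_mul, Matrix.transpose_mul]
    calc _ = (h : Matrix ι ι R)ᵀ * ((g : Matrix ι ι R)ᵀ * ψ.map (algebraMap k R) *
          (g : Matrix ι ι R)) * (h : Matrix ι ι R) := by simp only [mul_assoc]
      _ = _ := by rw [hg, hh]
  inv_mem' := by
    intro g hg
    simp only [Set.mem_ofPred_eq] at hg ⊢
    have h1 : (g : Matrix ι ι R) * ((g⁻¹ : GL ι R) : Matrix ι ι R) = 1 := by
      rw [← Units.val_mul, mul_inv_cancel, Units.val_one]
    have h2 : ((g⁻¹ : GL ι R) : Matrix ι ι R)ᵀ * (g : Matrix ι ι R)ᵀ = 1 := by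
      rw [← Matrix.transpose_mul, h1, Matrix.transpose_one]
    conv_lhs => rw [← hg]
    calc _ = (((g⁻¹ : GL ι R) : Matrix ι ι R)ᵀ * (g : Matrix ι ι R)ᵀ) * ψ.map (algebraMap k R) *
          ((g : Matrix ι ι R) * ((g⁻¹ : GL ι R) : Matrix ι ι R)) := by simp only [mul_assoc]
      _ = _ := by rw [h1, h2, one_mul, mul_one]

lemma toPoints_mem_isoGroup {ψ : Matrix ι ι k} {g : GL ι k} (hg : g ∈ isoGroup ψ k) :
    toPoints ι k R g ∈ isoGroup ψ R := by
  have hg' : (g : Matrix ι ι k)ᵀ * ψ.map (algebraMap k k) * (g : Matrix ι ι k) =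
    ψ.map (algebraMap k k) := hg
  have e : ψ.map (algebraMap k k) = ψ := by ext i j; rfl
  rw [e] at hg'
  have h := congrArg (fun M : Matrix ι ι k => M.map (algebraMap k R)) hg'
  simp only [Matrix.map_mul] at h
  exact h

end LinearGroups

section Quotients

/-- The homomorphism `H / N → H' / N'` induced by a homomorphism of the ambient groups that maps
`H` into `H'` and `N` into `N'`. -/
def quotMap {Γ Γ' : Type*} [Group Γ] [Group Γ'] (f : Γ →* Γ') (H N : Subgroup Γ)
    (H' N' : Subgroup Γ') [(N.subgroupOf H).Normal] [(N'.subgroupOf H').Normal]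
    (hH : H ≤ H'.comap f) (hN : N ≤ N'.comap f) :
    H ⧸ N.subgroupOf H →* H' ⧸ N'.subgroupOf H' :=
  QuotientGroup.map _ _ ((f.comp H.subtype).codRestrict H' fun x => hH x.2) fun _ hx => hN hx

variable {ι : Type*} [Fintype ι] [DecidableEq ι] {k : Type*} [Field k]
variable {G : Type*} [Group G]

/-!
Below `ρ` is a representation of a group `G` on `k ^ ι`, and `ψ` is the Gram matrix of a bilinear
form. In the application, `G` is the absolute Galois group of `K`, and `N` is either the whole
group or the absolute Galois group of a Galois extension of `K`.
-/

/-- The image `ρ(N)`. -/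
def image (ρ : G →* GL ι k) (N : Subgroup G) : Subgroup (GL ι k) := N.map ρ

/-- The isometries in the image, `ρ(N)₁`. -/
def image₁ (ρ : G →* GL ι k) (ψ : Matrix ι ι k) (N : Subgroup G) : Subgroup (GL ι k) :=
  image ρ N ⊓ isoGroup ψ k

/-- The `R`-points of the Zariski closure `G^alg` of `ρ(N)`. -/
def algGroup (ρ : G →* GL ι k) (N : Subgroup G) (R : Type*) [CommRing R] [Algebra k R] :
    Subgroup (GL ι R) :=
  zariskiClosure (image ρ N) R

/-- The `R`-points of `G^alg₁`, the intersection of `G^alg` with the isometry group. -/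
def algGroup₁ (ρ : G →* GL ι k) (ψ : Matrix ι ι k) (N : Subgroup G) (R : Type*) [CommRing R]
    [Algebra k R] : Subgroup (GL ι R) :=
  algGroup ρ N R ⊓ isoGroup ψ R

lemma image_conj (ρ : G →* GL ι k) (N : Subgroup G) [hN : N.Normal] :
    ∀ t ∈ image ρ ⊤, ∀ s ∈ image ρ N, t * s * t⁻¹ ∈ image ρ N := by
  rintro _ ⟨g, -, rfl⟩ _ ⟨h, hh, rfl⟩
  exact ⟨g * h * g⁻¹, hN.conj_mem h hh g, by simp⟩

instance image_normal (ρ : G →* GL ι k) (N : Subgroup G) [N.Normal] :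
    ((image ρ N).subgroupOf (image ρ ⊤)).Normal :=
  ⟨fun s hs t => image_conj ρ N t.1 t.2 s.1 hs⟩

instance algGroup_normal (ρ : G →* GL ι k) (N : Subgroup G) [N.Normal] (R : Type*) [CommRing R]
    [Algebra k R] : ((algGroup ρ N R).subgroupOf (algGroup ρ ⊤ R)).Normal :=
  ⟨fun _ hs t => zariskiClosure_conj (image_conj ρ N) t.2 hs⟩

instance image₁_normal (ρ : G →* GL ι k) (ψ : Matrix ι ι k) (N : Subgroup G) [N.Normal] :
    ((image₁ ρ ψ N).subgroupOf (image₁ ρ ψ ⊤)).Normal :=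
  Subgroup.inf_subgroupOf_inf_normal_of_left (isoGroup ψ k)

instance algGroup₁_normal (ρ : G →* GL ι k) (ψ : Matrix ι ι k) (N : Subgroup G) [N.Normal]
    (R : Type*) [CommRing R] [Algebra k R] :
    ((algGroup₁ ρ ψ N R).subgroupOf (algGroup₁ ρ ψ ⊤ R)).Normal :=
  Subgroup.inf_subgroupOf_inf_normal_of_left (isoGroup ψ R)

lemma image_le_comap (ρ : G →* GL ι k) (N : Subgroup G) (R : Type*) [CommRing R] [Algebra k R] :
    image ρ N ≤ (algGroup ρ N R).comap (toPoints ι k R) :=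
  fun _ hs => toPoints_mem_zariskiClosure hs

lemma image₁_le_comap (ρ : G →* GL ι k) (ψ : Matrix ι ι k) (N : Subgroup G) (R : Type*)
    [CommRing R] [Algebra k R] : image₁ ρ ψ N ≤ (algGroup₁ ρ ψ N R).comap (toPoints ι k R) :=
  fun _ hs => ⟨toPoints_mem_zariskiClosure hs.1, toPoints_mem_isoGroup hs.2⟩

/-- The map `Zar : ρ(G) / ρ(N) → G^alg(R) / N^alg(R)`. -/
noncomputable def zar (ρ : G →* GL ι k) (N : Subgroup G) [N.Normal] (R : Type*) [CommRing R]
    [Algebra k R] : image ρ ⊤ ⧸ (image ρ N).subgroupOf (image ρ ⊤) →*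
      algGroup ρ ⊤ R ⧸ (algGroup ρ N R).subgroupOf (algGroup ρ ⊤ R) :=
  quotMap (toPoints ι k R) _ _ _ _ (image_le_comap ρ ⊤ R) (image_le_comap ρ N R)

/-- The map `Zar₁ : ρ(G)₁ / ρ(N)₁ → G^alg₁(R) / N^alg₁(R)`. -/
noncomputable def zar₁ (ρ : G →* GL ι k) (ψ : Matrix ι ι k) (N : Subgroup G) [N.Normal]
    (R : Type*) [CommRing R] [Algebra k R] :
    image₁ ρ ψ ⊤ ⧸ (image₁ ρ ψ N).subgroupOf (image₁ ρ ψ ⊤) →*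
      algGroup₁ ρ ψ ⊤ R ⧸ (algGroup₁ ρ ψ N R).subgroupOf (algGroup₁ ρ ψ ⊤ R) :=
  quotMap (toPoints ι k R) _ _ _ _ (image₁_le_comap ρ ψ ⊤ R) (image₁_le_comap ρ ψ N R)

/-- The map `j : ρ(G)₁ / ρ(N)₁ → ρ(G) / ρ(N)` induced by inclusion. -/
def jMap (ρ : G →* GL ι k) (ψ : Matrix ι ι k) (N : Subgroup G) [N.Normal] :
    image₁ ρ ψ ⊤ ⧸ (image₁ ρ ψ N).subgroupOf (image₁ ρ ψ ⊤) →*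
      image ρ ⊤ ⧸ (image ρ N).subgroupOf (image ρ ⊤) :=
  quotMap (MonoidHom.id _) _ _ _ _ (fun _ h => h.1) (fun _ h => h.1)

/-- The map `i : G^alg₁(R) / N^alg₁(R) → G^alg(R) / N^alg(R)` induced by inclusion. -/
def iMap (ρ : G →* GL ι k) (ψ : Matrix ι ι k) (N : Subgroup G) [N.Normal]
    (R : Type*) [CommRing R] [Algebra k R] :
    algGroup₁ ρ ψ ⊤ R ⧸ (algGroup₁ ρ ψ N R).subgroupOf (algGroup₁ ρ ψ ⊤ R) →*
      algGroup ρ ⊤ R ⧸ (algGroup ρ N R).subgroupOf (algGroup ρ ⊤ R) :=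
  quotMap (MonoidHom.id _) _ _ _ _ (fun _ h => h.1) (fun _ h => h.1)

/-- The elements of `G` that `ρ` maps into the identity component of the Zariski closure of the
image of `ρ`. -/
noncomputable def connSubgroup (ρ : G →* GL ι k) : Subgroup G :=
  (identityPoints (image ρ ⊤)).comap ρ

instance connSubgroup_normal (ρ : G →* GL ι k) : (connSubgroup ρ).Normal :=
  ⟨fun s hs t => by
    have h := identityPoints_conj (S := image ρ ⊤) (s := ρ t) ⟨t, trivial, rfl⟩ hs
    rwa [← map_inv, ← map_mul, ← map_mul] at h⟩

end Quotients

section Galois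

variable {K Ω : Type*} [Field K] [Field Ω] [Algebra K Ω]
variable {ι : Type*} [Fintype ι] [DecidableEq ι] {k : Type*} [Field k]

/-- The field of connectedness `K₀`: the fixed field of the elements of the Galois group that are
mapped into the identity component of the Zariski closure of the image of `ρ`. -/
noncomputable def connField (ρ : Gal(Ω/K) →* GL ι k) : IntermediateField K Ω :=
  IntermediateField.fixedField (connSubgroup ρ)

instance connField_normal (ρ : Gal(Ω/K) →* GL ι k) : (connField ρ).fixingSubgroup.Normal := by
  refine ⟨fun s hs t => ?_⟩
  rw [IntermediateField.mem_fixingSubgroup_iff] at hs ⊢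
  intro x hx
  have hx' : t⁻¹ x ∈ connField ρ := by
    rw [connField, IntermediateField.mem_fixedField_iff] at hx ⊢
    intro f hf
    have h : t (f (t⁻¹ x)) = x := hx (t * f * t⁻¹) ((connSubgroup_normal ρ).conj_mem f hf t)
    calc f (t⁻¹ x) = (t⁻¹ * t) (f (t⁻¹ x)) := by rw [inv_mul_cancel, AlgEquiv.one_apply]
      _ = t⁻¹ (t (f (t⁻¹ x))) := rfl
      _ = t⁻¹ x := congrArg _ h
  calc (t * s * t⁻¹) x = t (s (t⁻¹ x)) := rfl
    _ = t (t⁻¹ x) := congrArg _ (hs _ hx')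
    _ = x := by rw [← AlgEquiv.mul_apply, mul_inv_cancel, AlgEquiv.one_apply]

/-- The `l`-adic cyclotomic character of the Galois group. -/
noncomputable def cyclo (K Ω : Type*) [Field K] [Field Ω] [Algebra K Ω] (l : ℕ) [Fact l.Prime] :
    Gal(Ω/K) →* ℤ_[l]ˣ :=
  (cyclotomicCharacter Ω l).comp (MulSemiringAction.toRingAut Gal(Ω/K) Ω)

/-- `l` for odd `l`, and `8` for `l = 2`. -/
def lBar (l : ℕ) : ℕ := if l = 2 then 8 else l

/-- The `n`-th power of the cyclotomic character modulo `lBar l`: the action on the `n`-th tensor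
power of the group of roots of unity of order dividing `lBar l`. -/
noncomputable def cycloPowMod (K Ω : Type*) [Field K] [Field Ω] [Algebra K Ω] (l : ℕ)
    [Fact l.Prime] (n : ℤ) : Gal(Ω/K) →* (ℤ_[l] ⧸ Ideal.span {(lBar l : ℤ_[l])})ˣ :=
  ((Units.map (Ideal.Quotient.mk (Ideal.span {(lBar l : ℤ_[l])})).toMonoidHom).comp
    (cyclo K Ω l)) ^ n

/-- The field `K(μ_{lBar}^{⊗ n})`, the fixed field of the kernel of `cycloPowMod`. -/
noncomputable def cycloField (K Ω : Type*) [Field K] [Field Ω] [Algebra K Ω] (l : ℕ)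
    [Fact l.Prime] (n : ℤ) : IntermediateField K Ω :=
  IntermediateField.fixedField (cycloPowMod K Ω l n).ker

end Galois

end GaloisZariski

/-!
Let `H` be the subgroup of elements that `ρ` maps into the identity component of the Zariski closure
of the image. The statement splits into a geometric and an arithmetic part.

*Geometry.* The closure is Noetherian, so it has finitely many connected components, and `H` has
finite index (`finite_quotient_connSubgroup`). The Zariski closures of the images of distinct cosets
of `H` lie in distinct connected components (`zeroLocus_vanIdeal_coset_subset`). They are therefore
disjoint, their ideals are pairwise coprime, and the closure of the whole image is their disjoint
union. By the Chinese remainder theorem this gives idempotents, and a point with values in a ring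
with connected spectrum lies on exactly one piece (`exists_le_ker_of_iInf_le_ker`). This shows that
`Zar` is bijective, without knowing that the closure of `ρ(H)` is the full identity component.

*Arithmetic.* Since `H` is the preimage of a closed set, it is a closed subgroup of finite index and
hence open; so it is the fixing subgroup of its fixed field (`fixingSubgroup_connField`), and the
disjointness of fields says that `H` and the kernel of the `n`-th power of the cyclotomic character
modulo `lBar l` generate the Galois group (`connSubgroup_sup_eq_top`). An element of this kernel has
multiplier congruent to `1` modulo `lBar l`, which by Hensel's lemma is a square `(1 + l * a) ^ 2`,
the multiplier of a homothety. The homotheties in the image are Zariski dense in the multiplicative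
group of scalars, which is connected, so they come from `H` (`scalarGL_mem_identityPoints`).
Correcting by them, every coset of `H` contains an element acting by an isometry
(`exists_mul_mem_isoGroup`); this is the surjectivity of `j`.

The maps `j` and `i` are injective by construction. As `i ∘ Zar₁ = Zar ∘ j` is bijective, so are `i`
and `Zar₁`. The coset decompositions follow from the same two facts.
-/

open scoped Matrix Pointwise

namespace GaloisZariski

/-! ### Components of the Zariski closure and translations -/

section Components
variable {ι : Type*} [Fintype ι] [DecidableEq ι] {k : Type*} [Field k]
variable {R : Type*} [CommRing R] [Algebra k R]

/-- The connected component of the `k`-point `g` in the closed subset of the spectrum that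
underlies the Zariski closure of `S`; it is empty when `g` is not a point of that closure. -/
noncomputable def componentOf (S : Subgroup (GL ι k)) (g : GL ι k) :
    Set (PrimeSpectrum (Poly ι k)) :=
  connectedComponentIn (PrimeSpectrum.zeroLocus (vanIdeal (S : Set (GL ι k)) : Set (Poly ι k)))
    (specPt g)

lemma isClosed_componentOf (S : Subgroup (GL ι k)) (g : GL ι k) :
    IsClosed (componentOf S g) := by
  have hZ := PrimeSpectrum.isClosed_zeroLocus (vanIdeal (S : Set (GL ι k)) : Set (Poly ι k))
  by_cases h : specPt g ∈ PrimeSpectrum.zeroLocus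
      (vanIdeal (S : Set (GL ι k)) : Set (Poly ι k))
  · rw [componentOf, connectedComponentIn_eq_image h]
    exact hZ.isClosedMap_subtype_val _ isClosed_connectedComponent
  · rw [componentOf, connectedComponentIn_eq_empty h]
    exact isClosed_empty

/-- Precomposition with `x ↦ a * x` acts on the spectrum as left translation by `a`. When `a` lies
in `S`, it maps components of the closure of `S` to components. -/
lemma comap_transHom_mem_componentOf {S : Subgroup (GL ι k)} {a g : GL ι k} (ha : a ∈ S)
    (hg : g ∈ S) {p : PrimeSpectrum (Poly ι k)} (hp : p ∈ componentOf S g) :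
    PrimeSpectrum.comap (transHom a 1).toRingHom p ∈ componentOf S (a * g) := by
  set φ := PrimeSpectrum.comap (transHom a 1).toRingHom
  have hφ : Continuous φ := PrimeSpectrum.continuous_comap _
  have hsub : φ '' componentOf S g ⊆
      PrimeSpectrum.zeroLocus (vanIdeal (S : Set (GL ι k)) : Set (Poly ι k)) := by
    rintro _ ⟨q, hq, rfl⟩ f hf
    refine connectedComponentIn_subset _ _ hq
      (?_ : transHom a 1 f ∈ vanIdeal (S : Set (GL ι k)))
    rw [mem_vanIdeal]
    intro s hs
    rw [evalAt_transHom, mul_one]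
    exact mem_vanIdeal.mp hf _ (S.mul_mem ha hs)
  have hpre : IsPreconnected (φ '' componentOf S g) :=
    isPreconnected_connectedComponentIn.image _ hφ.continuousOn
  have hmem : specPt (a * g) ∈ φ '' componentOf S g :=
    ⟨specPt g, mem_connectedComponentIn (specPt_mem_zeroLocus.mpr (le_zariskiClosure hg)),
      (comap_transHom_specPt a 1 g).trans (by rw [mul_one])⟩
  exact hpre.subset_connectedComponentIn hmem hsub ⟨p, hp, rfl⟩

/-- Two elements of `S` lie in the same component of the closure exactly when they are congruent
modulo the identity component. -/
lemma specPt_mem_componentOf_iff {S : Subgroup (GL ι k)} {g h : GL ι k} (hg : g ∈ S) :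
    specPt h ∈ componentOf S g ↔ g⁻¹ * h ∈ identityPoints S := by
  constructor
  · intro H
    have := comap_transHom_mem_componentOf (S.inv_mem hg) hg H
    rw [comap_transHom_specPt, mul_one, inv_mul_cancel] at this
    exact this
  · intro H
    have := comap_transHom_mem_componentOf (g := 1) hg S.one_mem H
    rw [comap_transHom_specPt, mul_one, mul_one, mul_inv_cancel_left] at this
    exact this

/-- The zero locus of the functions vanishing on `T` is the smallest closed set containing `T`. -/
lemma zeroLocus_vanIdeal_subset {T : Set (GL ι k)} {C : Set (PrimeSpectrum (Poly ι k))}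
    (hC : IsClosed C) (hT : ∀ t ∈ T, specPt t ∈ C) :
    PrimeSpectrum.zeroLocus (vanIdeal T : Set (Poly ι k)) ⊆ C := by
  obtain ⟨J, rfl⟩ := (PrimeSpectrum.isClosed_iff_zeroLocus C).mp hC
  exact PrimeSpectrum.zeroLocus_anti_mono fun f hf => mem_vanIdeal.mpr fun t ht => hT t ht hf

lemma evalAt_transHom_points (a b : GL ι k) (g : GL ι R) (f : Poly ι k) :
    evalAt k g (transHom a b f) = evalAt k (toPoints ι k R a * g * toPoints ι k R b) f := by
  have h2 := MvPolynomial.comp_aeval_apply (transVar a b) (evalAt k g) f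
  have h3 : (fun i => (evalAt k g) (transVar a b i)) =
      coords (toPoints ι k R a * g * toPoints ι k R b) :=
    funext fun i => aeval_transVar a b g i
  rw [h3] at h2
  exact h2

/-- The Zariski closure of a left coset lies in the left coset of the Zariski closure. -/
lemma inv_mul_mem_zariskiClosure {N : Subgroup (GL ι k)} {s : GL ι k} {g : GL ι R}
    (hg : ∀ f ∈ vanIdeal (s • (N : Set (GL ι k))), evalAt k g f = 0) :
    (toPoints ι k R s)⁻¹ * g ∈ zariskiClosure N R := by
  intro f hf
  have := hg (transHom s⁻¹ 1 f) <| mem_vanIdeal.mpr <| by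
    rintro _ ⟨t, ht, rfl⟩
    rw [evalAt_transHom]
    simpa using mem_vanIdeal.mp hf t ht
  rwa [evalAt_transHom_points, map_one, mul_one, map_inv] at this

end Components

/-! ### Points with connected spectrum of a finite disjoint union -/

section ConnectedSpectrum

lemma _root_.IsIdempotentElem.eq_zero_or_one_of_connectedSpace {R : Type*} [CommRing R]
    [ConnectedSpace (PrimeSpectrum R)] {e : R} (he : IsIdempotentElem e) : e = 0 ∨ e = 1 := by
  have hc := PrimeSpectrum.isClopen_iff.mpr ⟨e, he, rfl⟩
  rcases isClopen_iff.mp hc with h | h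
  · left
    refine PrimeSpectrum.basicOpen_injOn_isIdempotentElem he IsIdempotentElem.zero ?_
    rw [PrimeSpectrum.basicOpen_zero]
    exact TopologicalSpace.Opens.ext h
  · right
    refine PrimeSpectrum.basicOpen_injOn_isIdempotentElem he IsIdempotentElem.one ?_
    rw [PrimeSpectrum.basicOpen_one]
    exact TopologicalSpace.Opens.ext h

/-- A point with connected spectrum of a finite disjoint union of closed subschemes factors through
one of them. -/
lemma exists_le_ker_of_iInf_le_ker {A R κ : Type*} [CommRing A] [CommRing R]
    [ConnectedSpace (PrimeSpectrum R)] [Finite κ] (φ : A →+* R) (I : κ → Ideal A)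
    (hI : Pairwise (Function.onFun IsCoprime I)) (hφ : ⨅ c, I c ≤ RingHom.ker φ) :
    ∃ c, I c ≤ RingHom.ker φ := by
  classical
  cases nonempty_fintype κ
  have hR : Nontrivial R := PrimeSpectrum.nonempty_iff_nontrivial.mp inferInstance
  -- `e c` is the indicator function of the `c`-th piece, up to functions vanishing on the union.
  have he : ∀ c, ∃ e : A, e - 1 ∈ I c ∧ ∀ d, d ≠ c → e ∈ I d := fun c => by
    obtain ⟨e, he⟩ := Ideal.exists_forall_sub_mem_ideal hI (Pi.single c 1)
    exact ⟨e, by simpa using he c, fun d hd => by simpa [hd] using he d⟩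
  choose e he1 he0 using he
  have hidem : ∀ c, IsIdempotentElem (φ (e c)) := fun c => by
    have : e c * (e c - 1) ∈ RingHom.ker φ := hφ <| Ideal.mem_iInf.mpr fun d => by
      by_cases hd : d = c
      · subst hd; exact Ideal.mul_mem_left _ _ (he1 d)
      · exact Ideal.mul_mem_right _ _ (he0 c d hd)
    rw [RingHom.mem_ker, mul_sub, mul_one, map_sub, map_mul, sub_eq_zero] at this
    exact this
  obtain ⟨c, hc⟩ : ∃ c, φ (e c) = 1 := by
    by_contra! hne
    have h0 : ∀ c, φ (e c) = 0 := fun c =>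
      (hidem c).eq_zero_or_one_of_connectedSpace.resolve_right (hne c)
    have : ∏ c, (e c - 1) ∈ RingHom.ker φ := hφ <| Ideal.mem_iInf.mpr fun d =>
      Ideal.mem_of_dvd _ (Finset.dvd_prod_of_mem _ (Finset.mem_univ d)) (he1 d)
    simp only [RingHom.mem_ker, map_prod, map_sub, h0, map_one, zero_sub, Finset.prod_const] at this
    exact (isUnit_one.neg.pow _).ne_zero this
  refine ⟨c, fun f hf => ?_⟩
  have : f * e c ∈ RingHom.ker φ := hφ <| Ideal.mem_iInf.mpr fun d => by
    by_cases hd : d = c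
    · subst hd; exact Ideal.mul_mem_right _ _ hf
    · exact Ideal.mul_mem_left _ _ (he0 c d hd)
  rwa [RingHom.mem_ker, map_mul, hc, mul_one] at this

end ConnectedSpectrum

/-! ### The closures of the cosets of the connected subgroup -/

section Cosets
variable {ι : Type*} [Fintype ι] [DecidableEq ι] {k : Type*} [Field k]
variable {G : Type*} [Group G] (ρ : G →* GL ι k)

lemma mem_image_top (σ : G) : ρ σ ∈ image ρ ⊤ := ⟨σ, trivial, rfl⟩

lemma specPt_mem_componentOf_image_iff (σ τ : G) :
    specPt (ρ τ) ∈ componentOf (image ρ ⊤) (ρ σ) ↔ σ⁻¹ * τ ∈ connSubgroup ρ := by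
  rw [specPt_mem_componentOf_iff (mem_image_top ρ σ), connSubgroup,
    Subgroup.mem_comap, map_mul, map_inv]

/-- An algebraic group has finitely many connected components. -/
instance finite_quotient_connSubgroup : Finite (G ⧸ connSubgroup ρ) := by
  let Z := PrimeSpectrum.zeroLocus
    (vanIdeal (image ρ ⊤ : Set (GL ι k)) : Set (Poly ι k))
  let pt : G → Z := fun σ =>
    ⟨specPt (ρ σ), specPt_mem_zeroLocus.mpr (le_zariskiClosure (mem_image_top ρ σ))⟩
  have : Finite (irreducibleComponents Z) :=
    (TopologicalSpace.NoetherianSpace.finite_irreducibleComponents (α := Z)).to_subtype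
  refine Finite.of_injective (fun c : G ⧸ connSubgroup ρ =>
    (⟨irreducibleComponent (pt c.out), irreducibleComponent_mem_irreducibleComponents _⟩ :
      irreducibleComponents Z)) fun c d hcd => ?_
  have h1 : pt d.out ∈ connectedComponent (pt c.out) := by
    refine irreducibleComponent_subset_connectedComponent ?_
    have : irreducibleComponent (pt c.out) = irreducibleComponent (pt d.out) :=
      congrArg (fun x : irreducibleComponents Z => x.1) hcd
    rw [this]
    exact mem_irreducibleComponent
  have h2 : specPt (ρ d.out) ∈ componentOf (image ρ ⊤) (ρ c.out) := by
    rw [componentOf, connectedComponentIn_eq_image (pt c.out).2]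
    exact ⟨_, h1, rfl⟩
  rw [← c.out_eq', ← d.out_eq']
  exact QuotientGroup.eq.mpr ((specPt_mem_componentOf_image_iff ρ _ _).mp h2)

lemma zeroLocus_vanIdeal_coset_subset (σ : G) :
    PrimeSpectrum.zeroLocus (vanIdeal (ρ σ • (image ρ (connSubgroup ρ) : Set (GL ι k))) :
      Set (Poly ι k)) ⊆ componentOf (image ρ ⊤) (ρ σ) := by
  refine zeroLocus_vanIdeal_subset (isClosed_componentOf _ _) ?_
  rintro _ ⟨_, ⟨h, hh, rfl⟩, rfl⟩
  change specPt (ρ σ * ρ h) ∈ _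
  rw [← map_mul, specPt_mem_componentOf_image_iff, inv_mul_cancel_left]
  exact hh

/-- The closures of the cosets of the connected subgroup lie in distinct connected components, so
that they are disjoint, and they cover the closure of the whole image. -/
lemma exists_inv_mul_mem_algGroup {R : Type*} [CommRing R] [Algebra k R]
    [ConnectedSpace (PrimeSpectrum R)] {g : GL ι R} (hg : g ∈ algGroup ρ ⊤ R) :
    ∃ σ : G, (toPoints ι k R (ρ σ))⁻¹ * g ∈ algGroup ρ (connSubgroup ρ) R := by
  let I : G ⧸ connSubgroup ρ → Ideal (Poly ι k) := fun c =>
    vanIdeal (ρ c.out • (image ρ (connSubgroup ρ) : Set (GL ι k)))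
  have hI : Pairwise (Function.onFun IsCoprime I) := by
    intro c d hcd
    rw [Function.onFun, Ideal.isCoprime_iff_sup_eq, ← PrimeSpectrum.zeroLocus_empty_iff_eq_top,
      PrimeSpectrum.zeroLocus_sup, Set.eq_empty_iff_forall_notMem]
    rintro p ⟨hpc, hpd⟩
    have h1 := connectedComponentIn_eq (zeroLocus_vanIdeal_coset_subset ρ _ hpc)
    have h2 := connectedComponentIn_eq (zeroLocus_vanIdeal_coset_subset ρ _ hpd)
    have h3 : specPt (ρ d.out) ∈ componentOf (image ρ ⊤) (ρ c.out) := by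
      rw [componentOf, h1, ← h2]
      exact mem_connectedComponentIn
        (specPt_mem_zeroLocus.mpr (le_zariskiClosure (mem_image_top ρ _)))
    refine hcd ?_
    rw [← c.out_eq', ← d.out_eq']
    exact QuotientGroup.eq.mpr ((specPt_mem_componentOf_image_iff ρ _ _).mp h3)
  have hker : ⨅ c, I c ≤ RingHom.ker (evalAt k g).toRingHom := by
    intro f hf
    refine hg f (mem_vanIdeal.mpr ?_)
    rintro _ ⟨σ, -, rfl⟩
    have hσ : (σ : G ⧸ connSubgroup ρ).out⁻¹ * σ ∈ connSubgroup ρ :=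
      QuotientGroup.eq.mp (Quotient.out_eq' _)
    exact mem_vanIdeal.mp (Ideal.mem_iInf.mp hf (σ : G ⧸ connSubgroup ρ)) _
      ⟨_, ⟨_, hσ, rfl⟩, by simp⟩
  obtain ⟨c, hc⟩ := exists_le_ker_of_iInf_le_ker _ I hI hker
  exact ⟨c.out, inv_mul_mem_zariskiClosure fun f hf => hc hf⟩

lemma mem_connSubgroup_of_toPoints_mem {R : Type*} [CommRing R] [Algebra k R] [Nontrivial R]
    {σ : G} (h : toPoints ι k R (ρ σ) ∈ algGroup ρ (connSubgroup ρ) R) : σ ∈ connSubgroup ρ := by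
  have h1 : specPt (ρ σ) ∈ componentOf (image ρ ⊤) (ρ 1) := by
    refine zeroLocus_vanIdeal_coset_subset ρ 1 fun f hf => ?_
    rw [map_one, one_smul] at hf
    have := h f hf
    rw [evalAt_toPoints] at this
    exact (algebraMap k R).injective (this.trans (map_zero _).symm)
  simpa using (specPt_mem_componentOf_image_iff ρ _ _).mp h1

end Cosets

/-! ### Scalars in the identity component -/

section Scalars
variable {ι : Type*} [Fintype ι] [DecidableEq ι] {k : Type*} [Field k]

/-- The scalar matrices, as a homomorphism from the multiplicative group. -/
def scalarGL (ι : Type*) [Fintype ι] [DecidableEq ι] (k : Type*) [Field k] : kˣ →* GL ι k :=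
  Units.map (Matrix.scalar ι).toMonoidHom

/-- Restriction of functions to the scalar matrices, whose coordinate ring is the ring of Laurent
polynomials. -/
noncomputable def scalarRestrict (ι : Type*) [DecidableEq ι] (k : Type*) [Field k] :
    Poly ι k →ₐ[k] LaurentPolynomial k :=
  MvPolynomial.aeval (Sum.elim (fun p => if p.1 = p.2 then LaurentPolynomial.T 1 else 0)
    (fun p => if p.1 = p.2 then LaurentPolynomial.T (-1) else 0))

lemma eval₂_scalarRestrict (t : kˣ) (f : Poly ι k) :
    LaurentPolynomial.eval₂ (RingHom.id k) t (scalarRestrict ι k f) =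
      evalAt k (scalarGL ι k t) f := by
  have : (LaurentPolynomial.eval₂ (RingHom.id k) t).comp (scalarRestrict ι k).toRingHom =
      (evalAt k (scalarGL ι k t)).toRingHom := by
    refine MvPolynomial.ringHom_ext (fun r => ?_) (fun i => ?_)
    · have : algebraMap k (LaurentPolynomial k) r = LaurentPolynomial.C r := rfl
      simp [scalarRestrict, evalAt, this]
    · rcases i with ⟨i, j⟩ | ⟨i, j⟩
      · by_cases h : i = j <;>
          simp [scalarRestrict, evalAt, coords, scalarGL, Matrix.diagonal_apply, h]
      · by_cases h : i = j <;>
          simp [scalarRestrict, evalAt, coords, scalarGL, ← map_inv, Matrix.diagonal_apply, h]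
  exact congrArg (fun φ : Poly ι k →+* k => φ f) this

lemma laurent_eq_zero_of_infinite_zeros {U : Set kˣ} (hU : U.Infinite) {f : LaurentPolynomial k}
    (hf : ∀ t ∈ U, LaurentPolynomial.eval₂ (RingHom.id k) t f = 0) : f = 0 := by
  obtain ⟨n, p, hp⟩ := f.exists_T_pow
  have h0 : p = 0 := by
    refine Polynomial.eq_zero_of_infinite_isRoot p
      ((hU.image (Units.val_injective.injOn)).mono ?_)
    rintro _ ⟨t, ht, rfl⟩
    have := congrArg (LaurentPolynomial.eval₂ (RingHom.id k) t) hp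
    rw [LaurentPolynomial.eval₂_toLaurent, map_mul, hf t ht, zero_mul] at this
    simpa [Polynomial.IsRoot, Polynomial.eval₂_eq_eval_map] using this
  rw [h0, map_zero] at hp
  exact ((LaurentPolynomial.isUnit_T (R := k) n).mul_left_eq_zero).mp hp.symm

/-- If `S` contains infinitely many scalars, its closure contains the multiplicative group of all
scalars, which is connected. -/
lemma scalarGL_mem_identityPoints {S : Subgroup (GL ι k)}
    (hS : {t : kˣ | scalarGL ι k t ∈ S}.Infinite) (t : kˣ) :
    scalarGL ι k t ∈ identityPoints S := by
  let φ := PrimeSpectrum.comap (scalarRestrict ι k).toRingHom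
  have hsub : Set.range φ ⊆
      PrimeSpectrum.zeroLocus (vanIdeal (S : Set (GL ι k)) : Set (Poly ι k)) := by
    rintro _ ⟨q, rfl⟩ f hf
    have : scalarRestrict ι k f = 0 := laurent_eq_zero_of_infinite_zeros hS fun u hu => by
      rw [eval₂_scalarRestrict]
      exact mem_vanIdeal.mp hf _ hu
    change scalarRestrict ι k f ∈ q.asIdeal
    rw [this]
    exact zero_mem _
  have hpt : ∀ u : kˣ, specPt (scalarGL ι k u) ∈ Set.range φ := fun u =>
    ⟨⟨RingHom.ker (LaurentPolynomial.eval₂ (RingHom.id k) u), RingHom.ker_isPrime _⟩, by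
      ext f
      change LaurentPolynomial.eval₂ (RingHom.id k) u (scalarRestrict ι k f) = 0 ↔
        evalAt k (scalarGL ι k u) f = 0
      rw [eval₂_scalarRestrict]⟩
  have hpre : IsPreconnected (Set.range φ) :=
    isPreconnected_range (PrimeSpectrum.continuous_comap _)
  have h1 : specPt (1 : GL ι k) ∈ Set.range φ := by simpa using hpt 1
  exact hpre.subset_connectedComponentIn h1 hsub (hpt t)

end Scalars

/-! ### Isometries in the cosets of the connected subgroup -/

section Galois

/-- An `l`-adic integer congruent to `1` modulo `l`, or modulo `8` for `l = 2`, is the square of an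
integer congruent to `1` modulo `l`. -/
lemma exists_sq_eq_of_lBar_dvd {l : ℕ} [Fact l.Prime] {u : ℤ_[l]}
    (hu : (lBar l : ℤ_[l]) ∣ u - 1) : ∃ a : ℤ_[l], (1 + (l : ℤ_[l]) * a) ^ 2 = u := by
  have hl : 1 < (l : ℝ) := by exact_mod_cast (Fact.out : l.Prime).one_lt
  have hnorm : ‖1 - u‖ < ‖(2 : ℤ_[l])‖ ^ 2 := by
    rw [norm_sub_rev]
    obtain ⟨c, hc⟩ := hu
    rw [hc, norm_mul]
    by_cases h2 : l = 2
    · subst h2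
      have h2' : ‖(2 : ℤ_[2])‖ = 2⁻¹ := by simpa using PadicInt.norm_p (p := 2)
      have h8 : ((lBar 2 : ℕ) : ℤ_[2]) = 2 ^ 3 := by norm_num [lBar]
      rw [h8, norm_pow, h2']
      have := PadicInt.norm_le_one c
      nlinarith
    · have h2' : ‖(2 : ℤ_[l])‖ = 1 := by
        refine le_antisymm (PadicInt.norm_le_one _) (not_lt.mp fun h => h2 ?_)
        have := (PadicInt.norm_natCast_lt_one_iff (p := l) (n := 2)).mp (by exact_mod_cast h)
        exact (Nat.prime_dvd_prime_iff_eq Fact.out Nat.prime_two).mp this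
      rw [h2', lBar, if_neg h2, PadicInt.norm_p, one_pow]
      calc (l : ℝ)⁻¹ * ‖c‖ ≤ (l : ℝ)⁻¹ * 1 := by gcongr; exact PadicInt.norm_le_one c
        _ < 1 := by rw [mul_one]; exact inv_lt_one_of_one_lt₀ hl
  obtain ⟨z, hz, hz1, -⟩ := hensels_lemma (p := l) (R := ℤ_[l])
    (F := Polynomial.X ^ 2 - Polynomial.C u) (a := 1) (by simpa [one_add_one_eq_two] using hnorm)
  have hz2 : ‖z - 1‖ < 1 := hz1.trans_le (PadicInt.norm_le_one _)
  obtain ⟨a, ha⟩ := (PadicInt.norm_lt_one_iff_dvd _).mp hz2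
  refine ⟨a, ?_⟩
  rw [← ha, add_sub_cancel]
  simpa [sub_eq_zero] using hz

variable {K Ω : Type*} [Field K] [Field Ω] [Algebra K Ω]
variable {ι : Type*} [Fintype ι] [DecidableEq ι]

lemma continuous_evalAt {k : Type*} [Field k] [TopologicalSpace k] [IsTopologicalRing k]
    (f : Poly ι k) : Continuous fun g : GL ι k => evalAt k g f := by
  have hc : Continuous (coords : GL ι k → Idx ι → k) := by
    refine continuous_pi fun i => ?_
    rcases i with p | p
    · exact Units.continuous_val.matrix_elem p.1 p.2
    · exact (Units.continuous_val.comp continuous_inv).matrix_elem p.1 p.2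
  refine ((MvPolynomial.continuous_eval f).comp hc).congr fun g => ?_
  exact congrArg (fun φ : Poly ι k →+* k => φ f) (MvPolynomial.coe_aeval_eq_eval (coords g)).symm

lemma isClosed_connSubgroup {k : Type*} [Field k] [TopologicalSpace k] [IsTopologicalRing k]
    [T1Space k] {G : Type*} [Group G] [TopologicalSpace G] {ρ : G →* GL ι k} (hρ : Continuous ρ) :
    IsClosed (connSubgroup ρ : Set G) := by
  obtain ⟨J, hJ⟩ := (PrimeSpectrum.isClosed_iff_zeroLocus _).mp
    (isClosed_componentOf (image ρ ⊤) 1)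
  have : (connSubgroup ρ : Set G) = ⋂ f ∈ J, {σ | evalAt k (ρ σ) f = 0} := by
    ext σ
    have : σ ∈ connSubgroup ρ ↔ specPt (ρ σ) ∈ PrimeSpectrum.zeroLocus J := by rw [← hJ]; rfl
    rw [SetLike.mem_coe, this, Set.mem_iInter₂]
    rfl
  rw [this]
  exact isClosed_biInter fun f _ =>
    isClosed_singleton.preimage ((continuous_evalAt f).comp hρ)

lemma fixingSubgroup_connField [IsGalois K Ω] {k : Type*} [Field k] [TopologicalSpace k]
    [IsTopologicalRing k] [T1Space k] {ρ : Gal(Ω/K) →* GL ι k} (hρ : Continuous ρ) :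
    (connField ρ).fixingSubgroup = connSubgroup ρ :=
  InfiniteGalois.fixingSubgroup_fixedField ⟨connSubgroup ρ, isClosed_connSubgroup hρ⟩

/-- The connected subgroup is open, so that its join with any subgroup is closed, and is therefore
everything as soon as the fixed fields are disjoint. -/
lemma connSubgroup_sup_eq_top [IsGalois K Ω] {k : Type*} [Field k] [TopologicalSpace k]
    [IsTopologicalRing k] [T1Space k] {ρ : Gal(Ω/K) →* GL ι k} (hρ : Continuous ρ)
    (M : Subgroup Gal(Ω/K)) (hM : connField ρ ⊓ IntermediateField.fixedField M = ⊥) :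
    connSubgroup ρ ⊔ M = ⊤ := by
  have : (connSubgroup ρ).FiniteIndex := Subgroup.finiteIndex_of_finite_quotient
  have ho : IsOpen ((connSubgroup ρ ⊔ M : Subgroup Gal(Ω/K)) : Set Gal(Ω/K)) :=
    Subgroup.isOpen_mono le_sup_left
      ((connSubgroup ρ).isOpen_of_isClosed_of_finiteIndex (isClosed_connSubgroup hρ))
  have hfix : IntermediateField.fixedField (connSubgroup ρ ⊔ M) = ⊥ :=
    le_bot_iff.mp <| hM ▸ le_inf (IntermediateField.fixedField_le le_sup_left)
      (IntermediateField.fixedField_le le_sup_right)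
  have := InfiniteGalois.fixingSubgroup_fixedField
    ⟨connSubgroup ρ ⊔ M, Subgroup.isClosed_of_isOpen _ ho⟩
  change (IntermediateField.fixedField (connSubgroup ρ ⊔ M)).fixingSubgroup =
    connSubgroup ρ ⊔ M at this
  rw [← this, hfix, IntermediateField.fixingSubgroup_bot]

lemma lBar_dvd_of_mem_ker {l : ℕ} [Fact l.Prime] {n : ℤ} {σ : Gal(Ω/K)}
    (hσ : σ ∈ (cycloPowMod K Ω l n).ker) :
    (lBar l : ℤ_[l]) ∣ ((cyclo K Ω l σ ^ (-n) : ℤ_[l]ˣ) : ℤ_[l]) - 1 := by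
  set q := Ideal.Quotient.mk (Ideal.span {(lBar l : ℤ_[l])})
  have h1 : (Units.map q.toMonoidHom (cyclo K Ω l σ)) ^ n = 1 := hσ
  have h2 : Units.map q.toMonoidHom (cyclo K Ω l σ ^ (-n)) = 1 := by
    rw [zpow_neg, map_inv, map_zpow, h1, inv_one]
  have h3 : q ((cyclo K Ω l σ ^ (-n) : ℤ_[l]ˣ) : ℤ_[l]) = q 1 := by
    rw [map_one]; exact congrArg Units.val h2
  exact Ideal.mem_span_singleton.mp (Ideal.Quotient.eq.mp h3)

/-- Every coset of the connected subgroup contains an element acting by isometries. The connected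
subgroup and the kernel of the `n`-th power of the cyclotomic character modulo `lBar l` generate
the Galois group. The multiplier of an element of that kernel is the square of some `1 + l * a`,
hence also the multiplier of a homothety in the image, which lies in the identity component. -/
lemma exists_mul_mem_isoGroup [IsGalois K Ω] {l : ℕ} [Fact l.Prime] {n : ℤ}
    {ψ : Matrix ι ι ℚ_[l]} (hψ : IsUnit ψ.det) {ρ : Gal(Ω/K) →* GL ι ℚ_[l]} (hρ : Continuous ρ)
    (hequiv : ∀ σ : Gal(Ω/K),
      (ρ σ : Matrix ι ι ℚ_[l])ᵀ * ψ * (ρ σ : Matrix ι ι ℚ_[l]) =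
        (((cyclo K Ω l σ ^ (-n) : ℤ_[l]ˣ) : ℤ_[l]) : ℚ_[l]) • ψ)
    (hdisj : connField ρ ⊓ cycloField K Ω l n = ⊥)
    (hhom : ∀ a : ℤ_[l], ∃ σ : Gal(Ω/K),
      (ρ σ : Matrix ι ι ℚ_[l]) = ((1 + (l : ℤ_[l]) * a : ℤ_[l]) : ℚ_[l]) • 1) (σ : Gal(Ω/K)) :
    ∃ τ ∈ connSubgroup ρ, ρ (σ * τ) ∈ isoGroup ψ ℚ_[l] := by
  rcases isEmpty_or_nonempty ι with hι | hι
  · exact ⟨1, one_mem _, Subsingleton.elim (α := Matrix ι ι ℚ_[l]) _ _⟩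
  have hψ0 : ψ ≠ 0 := by
    rintro rfl
    simp [Matrix.det_zero] at hψ
  obtain ⟨m, hm, h, hh, hσ⟩ : ∃ m ∈ (cycloPowMod K Ω l n).ker, ∃ h ∈ connSubgroup ρ, m * h = σ :=
    Subgroup.mem_sup_of_normal_left.mp <| by
      rw [sup_comm, connSubgroup_sup_eq_top hρ _ hdisj]
      trivial
  obtain ⟨a, ha⟩ := exists_sq_eq_of_lBar_dvd (lBar_dvd_of_mem_ker hm)
  obtain ⟨α, hα⟩ := hhom a
  have hα_mult : cyclo K Ω l α ^ (-n) = cyclo K Ω l m ^ (-n) := by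
    have h1 := hequiv α
    rw [hα, Matrix.transpose_smul, Matrix.transpose_one, smul_mul_assoc, one_mul,
      mul_smul_comm, mul_one, smul_smul] at h1
    have h2 := smul_left_injective ℚ_[l] hψ0 h1
    replace h2 := (PadicInt.coe_mul _ _).trans h2
    rw [← sq, ha] at h2
    exact (Units.ext (PadicInt.ext h2)).symm
  have hα_conn : α ∈ connSubgroup ρ := by
    have hinf : {t : ℚ_[l]ˣ | scalarGL ι ℚ_[l] t ∈ image ρ ⊤}.Infinite := by
      have hne : ∀ N : ℕ, ((1 + l * N : ℕ) : ℚ_[l]) ≠ 0 := fun N =>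
        Nat.cast_ne_zero.mpr (by omega)
      refine Set.infinite_of_injective_forall_mem (f := fun N : ℕ => Units.mk0 _ (hne N))
        (fun M N hMN => ?_) fun N => ?_
      · have := Nat.cast_injective (congrArg Units.val hMN)
        exact Nat.eq_of_mul_eq_mul_left (Fact.out : l.Prime).pos (Nat.add_left_cancel this)
      · obtain ⟨β, hβ⟩ := hhom N
        refine ⟨β, trivial, Units.ext (hβ.trans ?_)⟩
        simp [scalarGL, Matrix.smul_one_eq_diagonal, Matrix.scalar_apply]
    have hne : ((1 + (l : ℤ_[l]) * a : ℤ_[l]) : ℚ_[l]) ≠ 0 := fun h0 => by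
      have : 1 + (l : ℤ_[l]) * a = 0 := PadicInt.ext h0
      rw [this, zero_pow two_ne_zero] at ha
      exact (cyclo K Ω l m ^ (-n)).ne_zero ha.symm
    have : ρ α = scalarGL ι ℚ_[l] (Units.mk0 _ hne) := Units.ext <| hα.trans <| by
      simp [scalarGL, Matrix.smul_one_eq_diagonal, Matrix.scalar_apply]
    rw [connSubgroup, Subgroup.mem_comap, this]
    exact scalarGL_mem_identityPoints hinf _
  refine ⟨h⁻¹ * α⁻¹, mul_mem (inv_mem hh) (inv_mem hα_conn), ?_⟩
  have h1 : cyclo K Ω l (σ * (h⁻¹ * α⁻¹)) ^ (-n) = 1 := by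
    rw [← hσ, mul_assoc, mul_inv_cancel_left, map_mul, mul_zpow, map_inv, inv_zpow, hα_mult,
      mul_inv_cancel]
  have h2 := hequiv (σ * (h⁻¹ * α⁻¹))
  rw [h1, Units.val_one, PadicInt.coe_one, one_smul] at h2
  exact h2

end Galois

/-! ### The commutative square and the coset decompositions -/

section Square
variable {ι : Type*} [Fintype ι] [DecidableEq ι] {k : Type*} [Field k]
variable {G : Type*} [Group G] {ρ : G →* GL ι k}

lemma mem_of_map_mem_image_connSubgroup {σ : G} (h : ρ σ ∈ image ρ (connSubgroup ρ)) :
    σ ∈ connSubgroup ρ :=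
  mem_connSubgroup_of_toPoints_mem (R := k) ρ (toPoints_mem_zariskiClosure h)

lemma quotMap_injective {Γ Γ' : Type*} [Group Γ] [Group Γ'] {f : Γ →* Γ'} {H N : Subgroup Γ}
    {H' N' : Subgroup Γ'} [(N.subgroupOf H).Normal] [(N'.subgroupOf H').Normal]
    {hH : H ≤ H'.comap f} {hN : N ≤ N'.comap f} (h : ∀ x ∈ H, f x ∈ N' → x ∈ N) :
    Function.Injective (quotMap f H N H' N' hH hN) := by
  rw [injective_iff_map_eq_one]
  intro q
  induction q using QuotientGroup.induction_on with
  | H x =>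
    intro hx
    exact (QuotientGroup.eq_one_iff _).mpr (h x x.2 <|
      (QuotientGroup.eq_one_iff (N := N'.subgroupOf H') ⟨f x, hH x.2⟩).mp hx)

lemma quotMap_surjective {Γ Γ' : Type*} [Group Γ] [Group Γ'] {f : Γ →* Γ'} {H N : Subgroup Γ}
    {H' N' : Subgroup Γ'} [(N.subgroupOf H).Normal] [(N'.subgroupOf H').Normal]
    {hH : H ≤ H'.comap f} {hN : N ≤ N'.comap f} (h : ∀ y ∈ H', ∃ x ∈ H, (f x)⁻¹ * y ∈ N') :
    Function.Surjective (quotMap f H N H' N' hH hN) := by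
  intro q
  induction q using QuotientGroup.induction_on with
  | H y =>
    obtain ⟨x, hx, hxy⟩ := h y y.2
    exact ⟨QuotientGroup.mk ⟨x, hx⟩, QuotientGroup.eq.mpr hxy⟩

lemma jMap_bijective {ψ : Matrix ι ι k}
    (hiso : ∀ σ, ∃ τ ∈ connSubgroup ρ, ρ (σ * τ) ∈ isoGroup ψ k) :
    Function.Bijective (jMap ρ ψ (connSubgroup ρ)) := by
  refine ⟨quotMap_injective fun x hx hxN => ⟨hxN, hx.2⟩, quotMap_surjective ?_⟩
  rintro _ ⟨σ, -, rfl⟩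
  obtain ⟨τ, hτ, h⟩ := hiso σ
  exact ⟨ρ (σ * τ), ⟨mem_image_top ρ _, h⟩, τ⁻¹, inv_mem hτ, by simp⟩

section Points
variable {R : Type*} [CommRing R] [Algebra k R]

lemma iMap_comp_zar₁ (ψ : Matrix ι ι k) (N : Subgroup G) [N.Normal] :
    (iMap ρ ψ N R).comp (zar₁ ρ ψ N R) = (zar ρ N R).comp (jMap ρ ψ N) := by
  ext x
  rfl

variable [ConnectedSpace (PrimeSpectrum R)]

lemma zar_bijective : Function.Bijective (zar ρ (connSubgroup ρ) R) := by
  have hR : Nontrivial R := PrimeSpectrum.nonempty_iff_nontrivial.mp inferInstance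
  refine ⟨quotMap_injective ?_, quotMap_surjective fun y hy => ?_⟩
  · rintro _ ⟨σ, -, rfl⟩ h
    exact ⟨σ, mem_connSubgroup_of_toPoints_mem ρ h, rfl⟩
  · obtain ⟨σ, hσ⟩ := exists_inv_mul_mem_algGroup ρ hy
    exact ⟨ρ σ, mem_image_top ρ σ, hσ⟩

lemma zar₁_bijective_and_iMap_bijective {ψ : Matrix ι ι k}
    (hiso : ∀ σ, ∃ τ ∈ connSubgroup ρ, ρ (σ * τ) ∈ isoGroup ψ k) :
    Function.Bijective (zar₁ ρ ψ (connSubgroup ρ) R) ∧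
      Function.Bijective (iMap ρ ψ (connSubgroup ρ) R) := by
  have hinj : Function.Injective (iMap ρ ψ (connSubgroup ρ) R) :=
    quotMap_injective fun x hx hxN => ⟨hxN, hx.2⟩
  have hcomp : Function.Bijective
      (iMap ρ ψ (connSubgroup ρ) R ∘ zar₁ ρ ψ (connSubgroup ρ) R) := by
    rw [← MonoidHom.coe_comp, iMap_comp_zar₁, MonoidHom.coe_comp]
    exact zar_bijective.comp (jMap_bijective hiso)
  have hi : Function.Bijective (iMap ρ ψ (connSubgroup ρ) R) := ⟨hinj, hcomp.2.of_comp⟩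
  exact ⟨(Function.Bijective.of_comp_iff' hi _).mp hcomp, hi⟩

lemma algGroup₁_eq_iUnion {ψ : Matrix ι ι k} {s : G ⧸ connSubgroup ρ → G}
    (hs : ∀ c, QuotientGroup.mk (s c) = c ∧ ρ (s c) ∈ image₁ ρ ψ ⊤) :
    (algGroup₁ ρ ψ ⊤ R : Set (GL ι R)) =
      ⋃ c, toPoints ι k R (ρ (s c)) • (algGroup₁ ρ ψ (connSubgroup ρ) R : Set (GL ι R)) := by
  have hsR : ∀ c, toPoints ι k R (ρ (s c)) ∈ algGroup₁ ρ ψ ⊤ R := fun c =>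
    image₁_le_comap ρ ψ ⊤ R (hs c).2
  ext g
  simp only [Set.mem_iUnion, Set.mem_smul_set_iff_inv_smul_mem, smul_eq_mul, SetLike.mem_coe]
  constructor
  · intro hg
    obtain ⟨σ, hσ⟩ := exists_inv_mul_mem_algGroup ρ hg.1
    have hiso : toPoints ι k R (ρ (s σ)) ∈ isoGroup ψ R := (hsR _).2
    refine ⟨σ, ?_, (isoGroup ψ R).mul_mem (inv_mem hiso) hg.2⟩
    have h1 : ρ ((s σ)⁻¹ * σ) ∈ image ρ (connSubgroup ρ) :=
      ⟨_, QuotientGroup.eq.mp (hs σ).1, rfl⟩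
    have h2 := mul_mem (toPoints_mem_zariskiClosure (R := R) h1) hσ
    rw [map_mul, map_mul, mul_assoc, mul_inv_cancel_left, map_inv, map_inv] at h2
    exact h2
  · rintro ⟨c, hc⟩
    have h1 : (toPoints ι k R (ρ (s c)))⁻¹ * g ∈ algGroup₁ ρ ψ ⊤ R :=
      ⟨zariskiClosure_mono (Subgroup.map_mono le_top) hc.1, hc.2⟩
    exact (mul_mem_cancel_left (inv_mem (hsR c))).mp h1

lemma pairwise_disjoint_algGroup₁ {ψ : Matrix ι ι k} {s : G ⧸ connSubgroup ρ → G}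
    (hs : ∀ c, QuotientGroup.mk (s c) = c) :
    Pairwise fun c d =>
      Disjoint (toPoints ι k R (ρ (s c)) • (algGroup₁ ρ ψ (connSubgroup ρ) R : Set (GL ι R)))
        (toPoints ι k R (ρ (s d)) • (algGroup₁ ρ ψ (connSubgroup ρ) R : Set (GL ι R))) := by
  have hR : Nontrivial R := PrimeSpectrum.nonempty_iff_nontrivial.mp inferInstance
  intro c d hcd
  rw [Set.disjoint_left]
  intro g hc hd
  rw [Set.mem_smul_set_iff_inv_smul_mem, smul_eq_mul, SetLike.mem_coe] at hc hd
  have hd' : (toPoints ι k R (ρ (s d)))⁻¹ * g ∈ algGroup ρ (connSubgroup ρ) R := hd.1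
  have h := (algGroup ρ (connSubgroup ρ) R).mul_mem hc.1 (inv_mem hd')
  rw [mul_inv_rev, inv_inv, mul_assoc, mul_inv_cancel_left, ← map_inv, ← map_inv, ← map_mul,
    ← map_mul] at h
  refine hcd ?_
  rw [← hs c, ← hs d]
  exact QuotientGroup.eq.mpr (mem_connSubgroup_of_toPoints_mem ρ h)

end Points

lemma image₁_eq_iUnion {ψ : Matrix ι ι k} {s : G ⧸ connSubgroup ρ → G}
    (hs : ∀ c, QuotientGroup.mk (s c) = c ∧ ρ (s c) ∈ image₁ ρ ψ ⊤) :
    (image₁ ρ ψ ⊤ : Set (GL ι k)) =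
      ⋃ c, ρ (s c) • (image₁ ρ ψ (connSubgroup ρ) : Set (GL ι k)) := by
  ext g
  simp only [Set.mem_iUnion, Set.mem_smul_set_iff_inv_smul_mem, smul_eq_mul, SetLike.mem_coe]
  constructor
  · rintro ⟨⟨σ, -, rfl⟩, hσ⟩
    have hiso : ρ (s σ) ∈ isoGroup ψ k := (hs σ).2.2
    exact ⟨σ, ⟨_, QuotientGroup.eq.mp (hs σ).1, by simp⟩,
      (isoGroup ψ k).mul_mem (inv_mem hiso) hσ⟩
  · rintro ⟨c, hc⟩
    have h1 : (ρ (s c))⁻¹ * g ∈ image₁ ρ ψ ⊤ := ⟨Subgroup.map_mono le_top hc.1, hc.2⟩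
    exact (mul_mem_cancel_left (inv_mem (hs c).2)).mp h1

lemma pairwise_disjoint_image₁ {ψ : Matrix ι ι k} {s : G ⧸ connSubgroup ρ → G}
    (hs : ∀ c, QuotientGroup.mk (s c) = c) :
    Pairwise fun c d =>
      Disjoint (ρ (s c) • (image₁ ρ ψ (connSubgroup ρ) : Set (GL ι k)))
        (ρ (s d) • (image₁ ρ ψ (connSubgroup ρ) : Set (GL ι k))) := by
  intro c d hcd
  rw [Set.disjoint_left]
  intro g hc hd
  rw [Set.mem_smul_set_iff_inv_smul_mem, smul_eq_mul, SetLike.mem_coe] at hc hd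
  have hd' : (ρ (s d))⁻¹ * g ∈ image ρ (connSubgroup ρ) := hd.1
  have h := (image ρ (connSubgroup ρ)).mul_mem hc.1 (inv_mem hd')
  rw [mul_inv_rev, inv_inv, mul_assoc, mul_inv_cancel_left, ← map_inv, ← map_mul] at h
  refine hcd ?_
  rw [← hs c, ← hs d]
  exact QuotientGroup.eq.mpr (mem_of_map_mem_image_connSubgroup h)

end Square
end GaloisZariski

open GaloisZariski in
/-- `K` is a number field, `Ω` an algebraic closure, `V_l = ℚ_l ^ ι` with a nondegenerate
alternating form of Gram matrix `ψ`, and `ρ` a continuous representation of the Galois group for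
which the form takes values in `ℚ_l(-n)`, with `n` odd. A homomorphism of quotients of group schemes
is an isomorphism when it is one on points in all `ℚ_l`-algebras `R` with connected spectrum,
for instance in an algebraic closure of `ℚ_l`. -/
theorem mainTheorem9 {K Ω : Type*} [Field K] [NumberField K] [Field Ω] [Algebra K Ω]
    [IsAlgClosure K Ω] (l : ℕ) [Fact l.Prime] {ι : Type*} [Fintype ι] [DecidableEq ι]
    (n : ℤ) (hn : Odd n)
    (ψ : Matrix ι ι ℚ_[l]) (hψ_alt : ψᵀ = -ψ) (hψ_nondeg : IsUnit ψ.det)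
    (ρ : Gal(Ω/K) →* GL ι ℚ_[l]) (hρ_cont : Continuous ρ)
    (hρ_equiv : ∀ σ : Gal(Ω/K),
      (ρ σ : Matrix ι ι ℚ_[l])ᵀ * ψ * (ρ σ : Matrix ι ι ℚ_[l]) =
        (((cyclo K Ω l σ ^ (-n) : ℤ_[l]ˣ) : ℤ_[l]) : ℚ_[l]) • ψ)
    (h_disjoint : connField ρ ⊓ cycloField K Ω l n = ⊥)
    (h_homotheties : ∀ a : ℤ_[l], ∃ σ : Gal(Ω/K),
      (ρ σ : Matrix ι ι ℚ_[l]) = ((1 + (l : ℤ_[l]) * a : ℤ_[l]) : ℚ_[l]) • 1) :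
    (Function.Bijective (jMap ρ ψ (connField ρ).fixingSubgroup) ∧
      ∀ (R : Type*) [CommRing R] [Algebra ℚ_[l] R] [ConnectedSpace (PrimeSpectrum R)],
        Function.Bijective (zar ρ (connField ρ).fixingSubgroup R) ∧
        Function.Bijective (zar₁ ρ ψ (connField ρ).fixingSubgroup R) ∧
        Function.Bijective (iMap ρ ψ (connField ρ).fixingSubgroup R) ∧
        (iMap ρ ψ (connField ρ).fixingSubgroup R).comp (zar₁ ρ ψ (connField ρ).fixingSubgroup R) =
          (zar ρ (connField ρ).fixingSubgroup R).comp (jMap ρ ψ (connField ρ).fixingSubgroup)) ∧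
    (∀ c : Gal(Ω/K) ⧸ (connField ρ).fixingSubgroup,
      ∃ σ₁ : Gal(Ω/K), (QuotientGroup.mk σ₁ : Gal(Ω/K) ⧸ (connField ρ).fixingSubgroup) = c ∧
        ρ σ₁ ∈ image₁ ρ ψ ⊤) ∧
    (∀ s : Gal(Ω/K) ⧸ (connField ρ).fixingSubgroup → Gal(Ω/K),
      (∀ c, QuotientGroup.mk (s c) = c ∧ ρ (s c) ∈ image₁ ρ ψ ⊤) →
      ((image₁ ρ ψ ⊤ : Set (GL ι ℚ_[l])) =
          ⋃ c, ρ (s c) • (image₁ ρ ψ (connField ρ).fixingSubgroup : Set (GL ι ℚ_[l])) ∧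
        Pairwise fun c d =>
          Disjoint (ρ (s c) • (image₁ ρ ψ (connField ρ).fixingSubgroup : Set (GL ι ℚ_[l])))
            (ρ (s d) • (image₁ ρ ψ (connField ρ).fixingSubgroup : Set (GL ι ℚ_[l])))) ∧
      ∀ (R : Type*) [CommRing R] [Algebra ℚ_[l] R] [ConnectedSpace (PrimeSpectrum R)],
        (algGroup₁ ρ ψ ⊤ R : Set (GL ι R)) =
          ⋃ c, toPoints ι ℚ_[l] R (ρ (s c)) •
            (algGroup₁ ρ ψ (connField ρ).fixingSubgroup R : Set (GL ι R)) ∧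
        Pairwise fun c d =>
          Disjoint (toPoints ι ℚ_[l] R (ρ (s c)) •
              (algGroup₁ ρ ψ (connField ρ).fixingSubgroup R : Set (GL ι R)))
            (toPoints ι ℚ_[l] R (ρ (s d)) •
              (algGroup₁ ρ ψ (connField ρ).fixingSubgroup R : Set (GL ι R)))) := by
  have : CharZero K := NumberField.to_charZero
  have : Normal K Ω := IsAlgClosure.normal K Ω
  have : Algebra.IsSeparable K Ω := Algebra.IsAlgebraic.isSeparable_of_perfectField
  have : IsGalois K Ω := ⟨⟩
  have hiso := exists_mul_mem_isoGroup hψ_nondeg hρ_cont hρ_equiv h_disjoint h_homotheties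
  have hN := fixingSubgroup_connField hρ_cont
  -- The normality instance is generalized too, so that the subgroup can be replaced.
  revert hN
  generalize connField_normal ρ = hnormal
  revert hnormal
  generalize (connField ρ).fixingSubgroup = N
  rintro hnormal rfl
  refine ⟨⟨jMap_bijective hiso, fun R _ _ _ => ⟨zar_bijective,
    (zar₁_bijective_and_iMap_bijective hiso).1, (zar₁_bijective_and_iMap_bijective hiso).2,
    iMap_comp_zar₁ ψ _⟩⟩, fun c => ?_, fun s hs =>
    ⟨⟨image₁_eq_iUnion hs, pairwise_disjoint_image₁ fun c => (hs c).1⟩, fun R _ _ _ =>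
      ⟨algGroup₁_eq_iUnion hs, pairwise_disjoint_algGroup₁ fun c => (hs c).1⟩⟩⟩
  obtain ⟨σ, rfl⟩ := QuotientGroup.mk_surjective c
  obtain ⟨τ, hτ, h⟩ := hiso σ
  exact ⟨σ * τ, QuotientGroup.mk_mul_of_mem σ hτ, mem_image_top ρ _, h⟩
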